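/- **Setting.** Let $d\ge 1$, $0<m<2$, and let $\|\cdot\|$ be the Euclidean norm on $\mathbb{R}^d$ and $\|\cdot\|_F$ the Frobenius norm. *Target.* Let $U:\mathbb{R}^d\to\mathbb{R}$ be twice continuously differentiable and attain a global minimum at some $x_*$ with $U(x_*)=0$, and suppose there are constants $d_k,D_k>0$ ($k=1,2,3$), $r>0$ and $R>0$ such that for all $x$ with $\|x\|\ge R$ $$d_1\|x\|^m\le U(x)\le D_1\|x\|^m,\qquad d_2\|x\|^{m-1}\le\|\nabla U(x)\|\le D_2\|x\|^{m-1},$$ $$\frac{\nabla U(x)}{\|\nabla U(x)\|}\cdot\frac{x}{\|x\|}\ge r,\qquad d_3\|x\|^{m-2}\le\|\nabla^2U(x)\|_F\le D_3\|x\|^{m-2}.$$ Let $\pi(dx)=Z^{-1}e^{-U(x)}\,dx$ with $Z=\int_{\mathbb{R}^d} e^{-U(x)}\,dx$. *Metropolis family.* Let $g_K$ be a Lebesgue probability density on $\mathbb{R}^d$ that vanishes off a compact set $K$, depends on $\xi$ only through $\|\xi\|$, and satisfies $\inf_{\xi\in K}g_K(\xi)>0$. Let $\lambda_*>0$, $\lambda^*\in\mathbb{R}$,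 and $$\mathcal{Y}=\{\gamma\in\mathbb{R}^{d\times d}:\gamma^T=\gamma,\ \lambda_*I\le\gamma\le\lambda^*I\}.$$ For $\gamma\in\mathcal{Y}$, $x\in\mathbb{R}^d$ and Borel $A\subseteq\mathbb{R}^d$ let, with $a(x,y)=\exp[U(x)-U(y)]\wedge1$, $$\mathcal{P}_\gamma(x,A)=\int_{\mathbb{R}^d}\mathbf{1}_A(x+\gamma^{1/2}\xi)\,a(x,x+\gamma^{1/2}\xi)\,g_K(\xi)\,d\xi+\delta_x(A)\Big(1-\int_{\mathbb{R}^d}a(x,x+\gamma^{1/2}\xi)\,g_K(\xi)\,d\xi\Big).$$ *Adaptive process.* An adaptation plan $\mathcal{Q}=(\mathcal{Q}_t)_{t\ge1}$ is a sequence of Borel probability kernels $\mathcal{Q}_t$ from $(\mathcal{Y}\times\mathbb{R}^d)^t$ to $\mathcal{Y}$; let $\mathcal{S}$ be the set of all adaptation plans. Given $\mathcal{Q}\in\mathcal{S}$, $\gamma_0\in\mathcal{Y}$ and $x_0\in\mathbb{R}^d$, the process $(\Gamma_t,X_t)_{t\ge0}$ starts at $(\Gamma_0,X_0)=(\gamma_0,x_0)$,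 and for $t\ge1$, given $(\Gamma_s,X_s)_{s\le t-1}$, first $\Gamma_t\sim\mathcal{Q}_t((\Gamma_s,X_s)_{s\le t-1},\cdot)$ and then $X_t\sim\mathcal{P}_{\Gamma_t}(X_{t-1},\cdot)$. Let $\mathcal{A}^{(t)}_{\mathcal{Q}}(\gamma_0,x_0,\cdot)$ be the law of $X_t$. *Distance.* For Borel probability measures $\mu,\nu$ on $\mathbb{R}^d$ let $\mathcal{W}_{\|\cdot\|\wedge1}(\mu,\nu)=\inf_\xi\int(\|x-y\|\wedge1)\,\xi(dx,dy)$, the infimum over all couplings $\xi$ of $\mu$ and $\nu$. **Claim.** With $d,m,U,g_K,\lambda_*,\lambda^*$ fixed, there is a constant $c_*>0$ such that for every $x_0\in\mathbb{R}^d$ there is a constant $M_*>0$ (depending on $x_0$) such that for all $\gamma_0\in\mathcal{Y}$ and all integers $t\ge0$ $$\inf_{\mathcal{Q}\in\mathcal{S}}\mathcal{W}_{\|\cdot\|\wedge1}\big(\mathcal{A}^{(t)}_{\mathcal{Q}}(\gamma_0,x_0,\cdot),\pi\big)\ \ge\ M_*\exp\big(-c_*\,t^{m/(2-m)}\big).$$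 -/

import Mathlib

open MeasureTheory ProbabilityTheory
open scoped MatrixOrder ENNReal

/-! ## Adaptive processes

`Y` is the space of tuning parameters, `X` the state space, and `P : Kernel (Y × X) X` a family of
Markov kernels `P (γ, x) = P_γ(x, ·)`. -/

section AdaptiveProcess

/-- An adaptation plan: `kernel t` is the conditional law of the tuning parameter `Γ_{t+1}` given
the history `(Γ_s, X_s)_{0 ≤ s ≤ t}`. -/
structure AdaptationPlan (Y X : Type) [MeasurableSpace Y] [MeasurableSpace X] where
  kernel : (t : ℕ) → Kernel (Finset.Iic t → Y × X) Y
  isMarkovKernel : ∀ t, IsMarkovKernel (kernel t)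

attribute [instance] AdaptationPlan.isMarkovKernel

/-- The conditional law of `(Γ_{t+1}, X_{t+1})` given the history up to time `t`: first
`Γ_{t+1} ∼ Q_{t+1}(history, ·)`, then `X_{t+1} ∼ P_{Γ_{t+1}}(X_t, ·)`. -/
noncomputable def adaptiveStep {Y X : Type} [MeasurableSpace Y] [MeasurableSpace X]
    (P : Kernel (Y × X) X) (Q : AdaptationPlan Y X) (t : ℕ) :
    Kernel (Finset.Iic t → Y × X) (Y × X) :=
  Q.kernel t ⊗ₖ P.comap
    (fun p : (Finset.Iic t → Y × X) × Y => (p.2, (p.1 ⟨t, Finset.mem_Iic.2 le_rfl⟩).2))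
    (by fun_prop)

instance {Y X : Type} [MeasurableSpace Y] [MeasurableSpace X]
    (P : Kernel (Y × X) X) [IsMarkovKernel P] (Q : AdaptationPlan Y X) (t : ℕ) :
    IsMarkovKernel (adaptiveStep P Q t) := by
  unfold adaptiveStep; infer_instance

/-- The law of the whole process `(Γ_t, X_t)_{t ≥ 0}` started at the fixed point `(γ₀, x₀)`
(Ionescu-Tulcea). -/
noncomputable def adaptiveLaw {Y X : Type} [MeasurableSpace Y] [MeasurableSpace X]
    (P : Kernel (Y × X) X) [IsMarkovKernel P] (Q : AdaptationPlan Y X) (γ₀ : Y) (x₀ : X) :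
    Measure (ℕ → Y × X) :=
  Kernel.traj (X := fun _ : ℕ => Y × X) (adaptiveStep P Q) 0 (fun _ => (γ₀, x₀))

/-- The law of `X_t`. -/
noncomputable def adaptiveMarginal {Y X : Type} [MeasurableSpace Y] [MeasurableSpace X]
    (P : Kernel (Y × X) X) [IsMarkovKernel P] (Q : AdaptationPlan Y X) (t : ℕ) (γ₀ : Y) (x₀ : X) :
    Measure X :=
  (adaptiveLaw P Q γ₀ x₀).map (fun ω => (ω t).2)

end AdaptiveProcess

/-! ## The bounded Wasserstein distance -/

/-- Couplings of two measures. -/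
def couplings {X : Type} [MeasurableSpace X] (μ ν : Measure X) : Set (Measure (X × X)) :=
  {ξ | IsProbabilityMeasure ξ ∧ ξ.map Prod.fst = μ ∧ ξ.map Prod.snd = ν}

/-- The Wasserstein distance with respect to the cost `d(x, y) ∧ 1`. -/
noncomputable def wassersteinMinOne {X : Type} [MeasurableSpace X] [PseudoMetricSpace X]
    (μ ν : Measure X) : ℝ≥0∞ :=
  ⨅ ξ ∈ couplings μ ν, ∫⁻ p, ENNReal.ofReal (min (dist p.1 p.2) 1) ∂ξ

/-! ## The target -/

/-- The probability measure `Z⁻¹ exp (-U x) dx`. -/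
noncomputable def gibbsMeasure {d : ℕ} (U : EuclideanSpace ℝ (Fin d) → ℝ) :
    Measure (EuclideanSpace ℝ (Fin d)) :=
  volume.withDensity fun x => ENNReal.ofReal (Real.exp (-U x) / ∫ y, Real.exp (-U y))

/-- The Hessian matrix of second partial derivatives. -/
noncomputable def hessianMatrix {d : ℕ} (U : EuclideanSpace ℝ (Fin d) → ℝ)
    (x : EuclideanSpace ℝ (Fin d)) : Matrix (Fin d) (Fin d) ℝ :=
  Matrix.of fun i j => fderiv ℝ (fun y => fderiv ℝ U y (EuclideanSpace.single j 1)) x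
    (EuclideanSpace.single i 1)

/-- The Frobenius norm. -/
noncomputable def frobeniusNorm {d : ℕ} (A : Matrix (Fin d) (Fin d) ℝ) : ℝ :=
  Real.sqrt (∑ i, ∑ j, A i j ^ 2)

/-- The regularity assumptions on the potential `U`, with growth exponent `m`. -/
structure PotentialRegularity {d : ℕ} (U : EuclideanSpace ℝ (Fin d) → ℝ) (m : ℝ) : Prop where
  contDiff : ContDiff ℝ 2 U
  exists_min : ∃ x₀, U x₀ = 0 ∧ ∀ x, U x₀ ≤ U x
  growth : ∃ d₁ d₂ d₃ D₁ D₂ D₃ r R : ℝ,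
    0 < d₁ ∧ 0 < d₂ ∧ 0 < d₃ ∧ 0 < D₁ ∧ 0 < D₂ ∧ 0 < D₃ ∧ 0 < r ∧ 0 < R ∧
    ∀ x, R ≤ ‖x‖ →
      (d₁ * ‖x‖ ^ m ≤ U x ∧ U x ≤ D₁ * ‖x‖ ^ m) ∧
      (d₂ * ‖x‖ ^ (m - 1) ≤ ‖gradient U x‖ ∧ ‖gradient U x‖ ≤ D₂ * ‖x‖ ^ (m - 1)) ∧
      r ≤ inner ℝ (‖gradient U x‖⁻¹ • gradient U x) (‖x‖⁻¹ • x) ∧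
      (d₃ * ‖x‖ ^ (m - 2) ≤ frobeniusNorm (hessianMatrix U x) ∧
        frobeniusNorm (hessianMatrix U x) ≤ D₃ * ‖x‖ ^ (m - 2))

/-! ## The set of covariance matrices -/

/-- Symmetric matrices `γ` with `lo • I ≤ γ ≤ hi • I` in the Loewner order. -/
def covarianceSet (d : ℕ) (lo hi : ℝ) : Set (Matrix (Fin d) (Fin d) ℝ) :=
  {γ | lo • (1 : Matrix (Fin d) (Fin d) ℝ) ≤ γ ∧ γ ≤ hi • (1 : Matrix (Fin d) (Fin d) ℝ) ∧
    γ.transpose = γ}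

noncomputable instance (d : ℕ) (lo hi : ℝ) : MeasurableSpace (covarianceSet d lo hi) := borel _

instance (d : ℕ) (lo hi : ℝ) : BorelSpace (covarianceSet d lo hi) := ⟨rfl⟩

theorem covarianceSet_nonneg {d : ℕ} {lo hi : ℝ} (hlo : 0 < lo) (γ : covarianceSet d lo hi) :
    (0 : Matrix (Fin d) (Fin d) ℝ) ≤ γ.1 := by
  refine le_trans ?_ γ.2.1
  rw [Matrix.nonneg_iff_posSemidef]
  exact Matrix.PosSemidef.one.smul hlo.le

/-- The square root `γ ↦ γ^{1/2}` is continuous on the set of covariance matrices. -/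
theorem continuous_sqrt_covarianceSet {d : ℕ} {lo hi : ℝ} (hlo : 0 < lo) :
    Continuous fun γ : covarianceSet d lo hi => CFC.sqrt γ.1 := by
  have h : ContinuousOn (CFC.sqrt (A := Matrix (Fin d) (Fin d) ℝ)) {a | 0 ≤ a} := by
    open scoped Matrix.Norms.L2Operator in
    exact CFC.continuousOn_sqrt
  exact h.comp_continuous continuous_subtype_val fun γ => covarianceSet_nonneg hlo γ

/-! ## Random-walk Metropolis -/

/-- A Lebesgue probability density `g` on `ℝᵈ`, radially symmetric, vanishing off a compact set `K`
and bounded below by a positive constant on `K`. -/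
structure ProposalDensity (d : ℕ) where
  g : EuclideanSpace ℝ (Fin d) → ℝ
  K : Set (EuclideanSpace ℝ (Fin d))
  measurable_g : Measurable g
  nonneg : ∀ ξ, 0 ≤ g ξ
  lintegral_eq_one : ∫⁻ ξ, ENNReal.ofReal (g ξ) = 1
  isCompact_K : IsCompact K
  eq_zero : ∀ ξ, ξ ∉ K → g ξ = 0
  radial : ∀ ξ η, ‖ξ‖ = ‖η‖ → g ξ = g η
  lower_bound : ∃ ε > 0, ∀ ξ ∈ K, ε ≤ g ξ

/-- The acceptance function `exp (U x - U y) ∧ 1`. -/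
noncomputable def acceptance {d : ℕ} (U : EuclideanSpace ℝ (Fin d) → ℝ)
    (x y : EuclideanSpace ℝ (Fin d)) : ℝ :=
  min (Real.exp (U x - U y)) 1

theorem acceptance_nonneg {d : ℕ} (U : EuclideanSpace ℝ (Fin d) → ℝ)
    (x y : EuclideanSpace ℝ (Fin d)) : 0 ≤ acceptance U x y :=
  le_min (Real.exp_pos _).le zero_le_one

/-- The proposed point `x + γ^{1/2} ξ`. -/
noncomputable def proposalPoint {d : ℕ} (γ : Matrix (Fin d) (Fin d) ℝ)
    (x ξ : EuclideanSpace ℝ (Fin d)) : EuclideanSpace ℝ (Fin d) :=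
  x + Matrix.toEuclideanCLM (𝕜 := ℝ) (CFC.sqrt γ) ξ

/-- The rejection probability. -/
noncomputable def rejection {d : ℕ} (U : EuclideanSpace ℝ (Fin d) → ℝ) (q : ProposalDensity d)
    (γ : Matrix (Fin d) (Fin d) ℝ) (x : EuclideanSpace ℝ (Fin d)) : ℝ :=
  1 - ∫ ξ, acceptance U x (proposalPoint γ x ξ) * q.g ξ

/-- The random-walk Metropolis transition probability
`A ↦ ∫ 1_A(x + γ^{1/2} ξ) a(x, x + γ^{1/2} ξ) g(ξ) dξ + R_γ(x) δ_x(A)`. -/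
noncomputable def rwmMeasure {d : ℕ} (U : EuclideanSpace ℝ (Fin d) → ℝ) (q : ProposalDensity d)
    (γ : Matrix (Fin d) (Fin d) ℝ) (x : EuclideanSpace ℝ (Fin d)) :
    Measure (EuclideanSpace ℝ (Fin d)) :=
  (volume.withDensity fun ξ =>
      ENNReal.ofReal (acceptance U x (proposalPoint γ x ξ) * q.g ξ)).map (proposalPoint γ x) +
    ENNReal.ofReal (rejection U q γ x) • Measure.dirac x

theorem measurable_proposalPoint_right {d : ℕ} (γ : Matrix (Fin d) (Fin d) ℝ)
    (x : EuclideanSpace ℝ (Fin d)) : Measurable (proposalPoint γ x) := by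
  unfold proposalPoint
  fun_prop

theorem measurable_proposalPoint {d : ℕ} {lo hi : ℝ} (hlo : 0 < lo) :
    Measurable fun p : (covarianceSet d lo hi × EuclideanSpace ℝ (Fin d)) ×
      EuclideanSpace ℝ (Fin d) => proposalPoint p.1.1.1 p.1.2 p.2 := by
  have h2 : Continuous fun p : (covarianceSet d lo hi) × EuclideanSpace ℝ (Fin d) =>
      WithLp.toLp 2 ((CFC.sqrt p.1.1).mulVec p.2.ofLp) :=
    (PiLp.continuous_toLp 2 _).comp (Continuous.matrix_mulVec
      ((continuous_sqrt_covarianceSet hlo).comp continuous_fst)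
      ((PiLp.continuous_ofLp 2 _).comp continuous_snd))
  have h4 : Measurable fun p : (covarianceSet d lo hi × EuclideanSpace ℝ (Fin d)) ×
      EuclideanSpace ℝ (Fin d) => (p.1.1, p.2) := by fun_prop
  exact (measurable_snd.comp measurable_fst).add (h2.measurable.comp h4)

theorem rwmMeasure_apply {d : ℕ} (U : EuclideanSpace ℝ (Fin d) → ℝ) (hU : Measurable U)
    (q : ProposalDensity d) (γ : Matrix (Fin d) (Fin d) ℝ) (x : EuclideanSpace ℝ (Fin d))
    {s : Set (EuclideanSpace ℝ (Fin d))} (hs : MeasurableSet s) :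
    rwmMeasure U q γ x s =
      (∫⁻ ξ, s.indicator (fun y => ENNReal.ofReal (acceptance U x y)) (proposalPoint γ x ξ) *
        ENNReal.ofReal (q.g ξ)) +
      ENNReal.ofReal (rejection U q γ x) * s.indicator 1 x := by
  have hp := measurable_proposalPoint_right γ x
  have ha : Measurable (acceptance U x) := by unfold acceptance; fun_prop
  unfold rwmMeasure
  rw [Measure.add_apply, Measure.map_apply hp hs, withDensity_apply _ (hp hs),
    Measure.smul_apply, Measure.dirac_apply' _ hs, smul_eq_mul, ← lintegral_indicator (hp hs)]
  congr 1
  refine lintegral_congr fun ξ => ?_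
  by_cases h : proposalPoint γ x ξ ∈ s
  · rw [Set.indicator_of_mem h, Set.indicator_of_mem (by exact h),
      ENNReal.ofReal_mul (acceptance_nonneg U x _)]
  · rw [Set.indicator_of_notMem h, Set.indicator_of_notMem (by exact h), zero_mul]

theorem isProbabilityMeasure_rwmMeasure {d : ℕ} (U : EuclideanSpace ℝ (Fin d) → ℝ)
    (hU : Measurable U) (q : ProposalDensity d) (γ : Matrix (Fin d) (Fin d) ℝ)
    (x : EuclideanSpace ℝ (Fin d)) : IsProbabilityMeasure (rwmMeasure U q γ x) := by
  have hp := measurable_proposalPoint_right γ x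
  have ha : Measurable (acceptance U x) := by unfold acceptance; fun_prop
  have hg := q.measurable_g
  have h0 : ∀ ξ, 0 ≤ acceptance U x (proposalPoint γ x ξ) * q.g ξ := fun ξ =>
    mul_nonneg (acceptance_nonneg U x _) (q.nonneg ξ)
  have hle : ∫⁻ ξ, ENNReal.ofReal (acceptance U x (proposalPoint γ x ξ) * q.g ξ) ≤ 1 := by
    rw [← q.lintegral_eq_one]
    refine lintegral_mono fun ξ => ENNReal.ofReal_le_ofReal ?_
    exact mul_le_of_le_one_left (q.nonneg ξ) (min_le_right _ _)
  have hint : ENNReal.ofReal (∫ ξ, acceptance U x (proposalPoint γ x ξ) * q.g ξ) =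
      ∫⁻ ξ, ENNReal.ofReal (acceptance U x (proposalPoint γ x ξ) * q.g ξ) := by
    rw [integral_eq_lintegral_of_nonneg_ae (Filter.Eventually.of_forall h0)
      (((ha.comp hp).mul hg).aestronglyMeasurable), ENNReal.ofReal_toReal]
    exact ne_top_of_le_ne_top ENNReal.one_ne_top hle
  refine ⟨?_⟩
  unfold rwmMeasure
  rw [Measure.add_apply, Measure.map_apply hp MeasurableSet.univ, Set.preimage_univ,
    withDensity_apply _ MeasurableSet.univ, Measure.restrict_univ, Measure.smul_apply,
    measure_univ, smul_eq_mul, mul_one, rejection,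
    ENNReal.ofReal_sub _ (integral_nonneg h0), hint, ENNReal.ofReal_one]
  exact add_tsub_cancel_of_le hle

theorem measurable_rwmMeasure {d : ℕ} (U : EuclideanSpace ℝ (Fin d) → ℝ) (hU : Measurable U)
    (q : ProposalDensity d) {lo hi : ℝ} (hlo : 0 < lo) :
    Measurable fun p : covarianceSet d lo hi × EuclideanSpace ℝ (Fin d) =>
      rwmMeasure U q p.1.1 p.2 := by
  have hp := measurable_proposalPoint (d := d) (hi := hi) hlo
  have hg := q.measurable_g
  have ha : Measurable fun p : EuclideanSpace ℝ (Fin d) × EuclideanSpace ℝ (Fin d) =>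
      acceptance U p.1 p.2 := by unfold acceptance; fun_prop
  have hap : Measurable fun p : (covarianceSet d lo hi × EuclideanSpace ℝ (Fin d)) ×
      EuclideanSpace ℝ (Fin d) => acceptance U p.1.2 (proposalPoint p.1.1.1 p.1.2 p.2) :=
    ha.comp ((measurable_snd.comp measurable_fst).prodMk hp)
  refine Measure.measurable_of_measurable_coe _ fun s hs => ?_
  simp_rw [rwmMeasure_apply U hU q _ _ hs]
  refine Measurable.add ?_ (Measurable.mul ?_ ?_)
  · refine Measurable.lintegral_prod_right' (f := fun p : (covarianceSet d lo hi ×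
      EuclideanSpace ℝ (Fin d)) × EuclideanSpace ℝ (Fin d) =>
      s.indicator (fun y => ENNReal.ofReal (acceptance U p.1.2 y))
        (proposalPoint p.1.1.1 p.1.2 p.2) * ENNReal.ofReal (q.g p.2)) ?_
    refine Measurable.mul ?_ (hg.comp measurable_snd).ennreal_ofReal
    exact (hap.ennreal_ofReal).indicator (hp hs)
  · refine Measurable.ennreal_ofReal (measurable_const.sub ?_)
    exact (StronglyMeasurable.integral_prod_right'
      (hap.mul (hg.comp measurable_snd)).stronglyMeasurable).measurable
  · exact (measurable_one.indicator hs).comp measurable_snd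

/-- The random-walk Metropolis family as a Markov kernel. -/
noncomputable def rwmKernel {d : ℕ} (U : EuclideanSpace ℝ (Fin d) → ℝ) (hU : Measurable U)
    (q : ProposalDensity d) {lo : ℝ} (hlo : 0 < lo) (hi : ℝ) :
    Kernel (covarianceSet d lo hi × EuclideanSpace ℝ (Fin d)) (EuclideanSpace ℝ (Fin d)) where
  toFun p := rwmMeasure U q p.1.1 p.2
  measurable' := measurable_rwmMeasure U hU q hlo

instance {d : ℕ} (U : EuclideanSpace ℝ (Fin d) → ℝ) (hU : Measurable U)
    (q : ProposalDensity d) {lo : ℝ} (hlo : 0 < lo) (hi : ℝ) :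
    IsMarkovKernel (rwmKernel U hU q hlo hi) :=
  ⟨fun p => isProbabilityMeasure_rwmMeasure U hU q p.1.1 p.2⟩

/-! `π` gives mass at least `exp (-C ρ ^ m)` to the complement of the ball of radius `ρ + 1`. Hence
a process that puts at most half as much outside the ball of radius `ρ` is at distance at least
`exp (-C ρ ^ m) / 2` from `π`, and everything depends on how slowly the mass can spread.

Increments are bounded, so radius `σ` takes a time of order `σ`; this suffices if `m ≥ 1`. If
`m < 1`, it takes a time of order `σ ^ (2 - m)`. A Metropolis rejection keeps the smaller of the two
values of `U`, so `E[exp (s U)]` is at most what the unfiltered random walk would give; the proposal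
is symmetric, so the first-order term of that walk averages out; and since `∇U` and `∇²U` are of
order `σ ^ (m - 1)` and `σ ^ (m - 2)` beyond radius `σ`, one step multiplies `E[exp (s U)]` by at
most `1 + O(σ ^ (2 m - 2))` there, whatever covariance is used. After `σ ^ (2 - m)` steps this
moment is still `exp (O(σ ^ m))`, and the Markov inequality with `s` large bounds the tail of `X_t`.
Given `t`, take `σ` of order `t ^ (1 / (2 - m))`. -/

section AdaptiveProcess

variable {Y X : Type} [MeasurableSpace Y] [MeasurableSpace X] (P : Kernel (Y × X) X)
  [IsMarkovKernel P] (Q : AdaptationPlan Y X) (γ₀ : Y) (x₀ : X)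

instance isProbabilityMeasure_adaptiveLaw : IsProbabilityMeasure (adaptiveLaw P Q γ₀ x₀) := by
  unfold adaptiveLaw; infer_instance

instance isProbabilityMeasure_adaptiveMarginal (t : ℕ) :
    IsProbabilityMeasure (adaptiveMarginal P Q t γ₀ x₀) :=
  Measure.isProbabilityMeasure_map (Measurable.aemeasurable (by fun_prop))

theorem lintegral_adaptiveMarginal (t : ℕ) {f : X → ℝ≥0∞} (hf : Measurable f) :
    ∫⁻ x, f x ∂adaptiveMarginal P Q t γ₀ x₀ = ∫⁻ ω, f (ω t).2 ∂adaptiveLaw P Q γ₀ x₀ :=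
  lintegral_map hf (by fun_prop)

theorem lintegral_adaptiveMarginal_zero {f : X → ℝ≥0∞} (hf : Measurable f) :
    ∫⁻ x, f x ∂adaptiveMarginal P Q 0 γ₀ x₀ = f x₀ := by
  rw [lintegral_adaptiveMarginal P Q γ₀ x₀ 0 hf, adaptiveLaw, Kernel.lintegral_traj _ (by fun_prop)]
  simp [Function.updateFinset]

theorem lintegral_adaptiveLaw_succ (t : ℕ) {f : Y × X → ℝ≥0∞} (hf : Measurable f) :
    ∫⁻ ω, f (ω (t + 1)) ∂adaptiveLaw P Q γ₀ x₀ =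
      ∫⁻ ω, ∫⁻ z, f z ∂adaptiveStep P Q t (Preorder.frestrictLe t ω) ∂adaptiveLaw P Q γ₀ x₀ := by
  let κ := Kernel.traj (X := fun _ : ℕ => Y × X) (adaptiveStep P Q)
  let ρ := Kernel.partialTraj (X := fun _ : ℕ => Y × X) (adaptiveStep P Q) 0 t
    (fun _ => (γ₀, x₀))
  have hρ : (adaptiveLaw P Q γ₀ x₀).map (Preorder.frestrictLe t) = ρ :=
    Kernel.traj_map_frestrictLe_apply _ _ _
  calc ∫⁻ ω, f (ω (t + 1)) ∂adaptiveLaw P Q γ₀ x₀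
      = ∫⁻ h, ∫⁻ ω, f (ω (t + 1)) ∂κ t h ∂ρ := by
        rw [adaptiveLaw, ← Kernel.traj_comp_partialTraj (Nat.zero_le t),
          Kernel.lintegral_comp _ _ _ (by fun_prop)]
    _ = ∫⁻ h, ∫⁻ z, f z ∂adaptiveStep P Q t h ∂ρ := by
        refine lintegral_congr fun h => ?_
        rw [← Kernel.map_traj_succ_self (X := fun _ : ℕ => Y × X) (κ := adaptiveStep P Q),
          Kernel.lintegral_map _ (by fun_prop) _ hf]
    _ = _ := by
        rw [← hρ, lintegral_map hf.lintegral_kernel (by fun_prop)]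

theorem lintegral_adaptiveMarginal_succ_le (t : ℕ) {f h : X → ℝ≥0∞} (hf : Measurable f)
    (hh : Measurable h) (hP : ∀ γ x, ∫⁻ y, f y ∂P (γ, x) ≤ h x) :
    ∫⁻ x, f x ∂adaptiveMarginal P Q (t + 1) γ₀ x₀ ≤ ∫⁻ x, h x ∂adaptiveMarginal P Q t γ₀ x₀ := by
  rw [lintegral_adaptiveMarginal P Q γ₀ x₀ (t + 1) hf, lintegral_adaptiveMarginal P Q γ₀ x₀ t hh,
    lintegral_adaptiveLaw_succ P Q γ₀ x₀ t (f := fun z => f z.2) (by fun_prop)]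
  refine lintegral_mono fun ω => ?_
  rw [adaptiveStep, Kernel.lintegral_compProd _ _ _ (by fun_prop)]
  calc _ ≤ ∫⁻ _, h (ω t).2 ∂Q.kernel t (Preorder.frestrictLe t ω) :=
        lintegral_mono fun γ => hP γ (ω t).2
    _ = h (ω t).2 := by simp

theorem lintegral_adaptiveMarginal_le_of_drift {f : X → ℝ≥0∞} (hf : Measurable f) {a b : ℝ≥0∞}
    (ha : 1 ≤ a) (hP : ∀ γ x, ∫⁻ y, f y ∂P (γ, x) ≤ a * f x + b) (t : ℕ) :
    ∫⁻ x, f x ∂adaptiveMarginal P Q t γ₀ x₀ ≤ a ^ t * (f x₀ + t * b) := by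
  induction t with
  | zero => simp [lintegral_adaptiveMarginal_zero P Q γ₀ x₀ hf]
  | succ t ih =>
    calc ∫⁻ x, f x ∂adaptiveMarginal P Q (t + 1) γ₀ x₀
        ≤ ∫⁻ x, (a * f x + b) ∂adaptiveMarginal P Q t γ₀ x₀ :=
          lintegral_adaptiveMarginal_succ_le P Q γ₀ x₀ t hf ((hf.const_mul a).add_const b) hP
      _ = a * ∫⁻ x, f x ∂adaptiveMarginal P Q t γ₀ x₀ + b := by
          rw [lintegral_add_right _ measurable_const, lintegral_const_mul _ hf, lintegral_const,
            measure_univ, mul_one]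
      _ ≤ a * (a ^ t * (f x₀ + t * b)) + a ^ (t + 1) * b := by
          gcongr
          exact le_mul_of_one_le_left' (one_le_pow₀ ha)
      _ = a ^ (t + 1) * (f x₀ + (t + 1 : ℕ) * b) := by push_cast; ring

theorem ae_mem_adaptiveMarginal_succ (t : ℕ) {s s' : Set X} (hs : MeasurableSet s)
    (hs' : MeasurableSet s') (hP : ∀ γ, ∀ x ∈ s, ∀ᵐ y ∂P (γ, x), y ∈ s')
    (h : ∀ᵐ x ∂adaptiveMarginal P Q t γ₀ x₀, x ∈ s) :
    ∀ᵐ x ∂adaptiveMarginal P Q (t + 1) γ₀ x₀, x ∈ s' := by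
  suffices adaptiveMarginal P Q (t + 1) γ₀ x₀ s'ᶜ ≤ adaptiveMarginal P Q t γ₀ x₀ sᶜ from
    nonpos_iff_eq_zero.1 (this.trans (ae_iff.1 h).le)
  rw [← lintegral_indicator_one hs.compl, ← lintegral_indicator_one hs'.compl]
  refine lintegral_adaptiveMarginal_succ_le P Q γ₀ x₀ t (measurable_one.indicator hs'.compl)
    (measurable_one.indicator hs.compl) fun γ x => ?_
  rw [lintegral_indicator_one hs'.compl]
  by_cases hx : x ∈ s
  · exact (ae_iff.1 (hP γ x hx)).le.trans zero_le
  · rw [Set.indicator_of_mem (by exact hx)]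
    exact prob_le_one

theorem ae_mem_closedBall_adaptiveMarginal [PseudoMetricSpace X] [OpensMeasurableSpace X] {L : ℝ}
    (hP : ∀ γ x, ∀ᵐ y ∂P (γ, x), dist y x ≤ L) (t : ℕ) :
    ∀ᵐ x ∂adaptiveMarginal P Q t γ₀ x₀, x ∈ Metric.closedBall x₀ (L * t) := by
  have hm (r : ℝ) : MeasurableSet (Metric.closedBall x₀ r) := measurableSet_closedBall
  induction t with
  | zero =>
    suffices adaptiveMarginal P Q 0 γ₀ x₀ (Metric.closedBall x₀ (L * (0 : ℕ)))ᶜ = 0 from this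
    rw [← lintegral_indicator_one (hm _).compl,
      lintegral_adaptiveMarginal_zero P Q γ₀ x₀ (measurable_one.indicator (hm _).compl)]
    simp
  | succ t ih =>
    refine ae_mem_adaptiveMarginal_succ P Q γ₀ x₀ t (hm _) (hm _) (fun γ x hx => ?_) ih
    filter_upwards [hP γ x] with y hy
    rw [Metric.mem_closedBall] at hx ⊢
    push_cast
    linarith [dist_triangle y x x₀]

end AdaptiveProcess

theorem measure_le_wassersteinMinOne_add_measure_compl {X : Type} [MeasurableSpace X]
    [PseudoMetricSpace X] (μ ν : Measure X) {s t : Set X} (hs : MeasurableSet s)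
    (ht : MeasurableSet t) (hst : ∀ x ∈ s, ∀ y ∈ t, 1 ≤ dist x y) :
    ν t ≤ wassersteinMinOne μ ν + μ sᶜ := by
  unfold wassersteinMinOne
  rw [ENNReal.iInf₂_add]
  refine le_iInf₂ fun ξ ⟨_, hμ, hν⟩ => ?_
  rw [← hμ, ← hν, Measure.map_apply measurable_snd ht, Measure.map_apply measurable_fst hs.compl,
    ← lintegral_indicator_one (measurable_snd ht),
    ← lintegral_indicator_one (measurable_fst hs.compl),
    ← lintegral_add_right _ (measurable_one.indicator (measurable_fst hs.compl))]
  refine lintegral_mono (Set.indicator_le fun p (hp : p.2 ∈ t) => ?_)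
  rw [Pi.one_apply]
  by_cases h : p.1 ∈ s
  · rw [min_eq_right (hst p.1 h p.2 hp), ENNReal.ofReal_one]
    exact le_self_add
  · rw [Set.indicator_of_mem (by exact h)]
    exact le_add_self

section TailDecay

open Filter Metric

theorem eventually_mul_rpow_le_exp_mul_rpow (C s : ℝ) {b m : ℝ} (hb : 0 < b) (hm : 0 < m) :
    ∀ᶠ σ : ℝ in atTop, C * σ ^ s ≤ Real.exp (b * σ ^ m) := by
  have h := ((isLittleO_rpow_exp_pos_mul_atTop (s / m) hb).comp_tendsto
    (tendsto_rpow_atTop hm)).const_mul_left C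
  filter_upwards [h.bound one_pos, eventually_gt_atTop 0] with σ hσ hσ0
  simp only [Function.comp_apply, ← Real.rpow_mul hσ0.le, mul_div_cancel₀ s hm.ne', one_mul,
    Real.norm_of_nonneg (Real.exp_pos _).le] at hσ
  exact (le_abs_self _).trans hσ

theorem one_add_mul_rpow_pow_le_exp {C σ m p : ℝ} (hC : 0 ≤ C) (hσ : 0 < σ) {t : ℕ}
    (ht : (t : ℝ) ≤ σ ^ p) : (1 + C * σ ^ (m - p)) ^ t ≤ Real.exp (C * σ ^ m) := by
  calc (1 + C * σ ^ (m - p)) ^ t ≤ Real.exp (C * σ ^ (m - p)) ^ t := by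
        gcongr
        linarith [Real.add_one_le_exp (C * σ ^ (m - p))]
    _ = Real.exp (C * σ ^ (m - p) * t) := by rw [← Real.exp_nat_mul, mul_comm]
    _ ≤ Real.exp (C * σ ^ (m - p) * σ ^ p) := by gcongr
    _ = Real.exp (C * σ ^ m) := by rw [mul_assoc, ← Real.rpow_add hσ, sub_add_cancel]

theorem one_add_mul_rpow_pow_mul_add_le {C σ m p u b : ℝ} (hC : 0 ≤ C) (hσ : 0 < σ) {t : ℕ}
    (ht : (t : ℝ) ≤ σ ^ p) (ht' : 1 + (t : ℝ) ≤ Real.exp (σ ^ m)) (hu₀ : 0 ≤ u)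
    (hu : u ≤ b) :
    (1 + C * σ ^ (m - p)) ^ t * (u + t * b) ≤ Real.exp ((C + 1) * σ ^ m) * b := by
  have hb : 0 ≤ b := hu₀.trans hu
  calc (1 + C * σ ^ (m - p)) ^ t * (u + t * b)
      ≤ Real.exp (C * σ ^ m) * (b + t * b) := by
        gcongr
        exact one_add_mul_rpow_pow_le_exp hC hσ ht
    _ = Real.exp (C * σ ^ m) * (1 + t) * b := by ring
    _ ≤ Real.exp (C * σ ^ m) * Real.exp (σ ^ m) * b := by gcongr
    _ = Real.exp ((C + 1) * σ ^ m) * b := by rw [← Real.exp_add, add_one_mul]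

variable {Y E : Type} [MeasurableSpace Y] [NormedAddCommGroup E] [MeasurableSpace E]
  {P : Kernel (Y × E) E} [IsMarkovKernel P] {m p : ℝ}

/-- Tail decay of the adaptive process up to the time scale `σ ^ p`, uniformly over the adaptation
plans: a process started in the ball of radius `σ` has not yet had the time to put more than
`exp (-A (B σ) ^ m)` of its mass outside a dilated ball of radius `B σ`. The dilation `B` may depend
on `A`, so that every prescribed rate `A` is reached. -/
def HasTailDecayUntil (P : Kernel (Y × E) E) [IsMarkovKernel P] (m p : ℝ) : Prop :=
  ∀ A : ℝ, ∃ B : ℝ, 1 ≤ B ∧ ∀ᶠ σ : ℝ in atTop, ∀ x₀ : E, ‖x₀‖ ≤ σ →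
    ∀ (γ₀ : Y) (t : ℕ), (t : ℝ) ≤ σ ^ p → ∀ Q : AdaptationPlan Y E,
      adaptiveMarginal P Q t γ₀ x₀ (closedBall 0 (B * σ))ᶜ ≤
        ENNReal.ofReal (Real.exp (-(A * (B * σ) ^ m)))

theorem HasTailDecayUntil.mono (hP : HasTailDecayUntil P m p) {p' : ℝ} (hp : p' ≤ p) :
    HasTailDecayUntil P m p' := by
  intro A
  obtain ⟨B, hB, h⟩ := hP A
  refine ⟨B, hB, ?_⟩
  filter_upwards [h, eventually_ge_atTop 1] with σ hσ hσ1 x₀ hx₀ γ₀ t ht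
  exact hσ x₀ hx₀ γ₀ t (ht.trans (Real.rpow_le_rpow_of_exponent_le hσ1 hp))

theorem hasTailDecayUntil_one [OpensMeasurableSpace E] {L : ℝ} (hL : 0 ≤ L)
    (hP : ∀ γ x, ∀ᵐ y ∂P (γ, x), dist y x ≤ L) (m : ℝ) : HasTailDecayUntil P m 1 := by
  refine fun A => ⟨1 + L, le_add_of_nonneg_right hL, Eventually.of_forall ?_⟩
  intro σ x₀ hx₀ γ₀ t ht Q
  rw [Real.rpow_one] at ht
  have hball : closedBall x₀ (L * t) ⊆ closedBall 0 ((1 + L) * σ) := by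
    refine closedBall_subset_closedBall' ?_
    rw [dist_zero_right]
    linarith [mul_le_mul_of_nonneg_left ht hL]
  have hnull : ∀ᵐ x ∂adaptiveMarginal P Q t γ₀ x₀, x ∈ closedBall 0 ((1 + L) * σ) :=
    (ae_mem_closedBall_adaptiveMarginal P Q γ₀ x₀ hP t).mono fun x hx => hball hx
  exact (ae_iff.1 hnull).le.trans zero_le

theorem eventually_lintegral_exp_adaptiveMarginal_le [OpensMeasurableSpace E] (hm : 0 < m)
    {L : ℝ} (hP : ∀ γ x, ∀ᵐ y ∂P (γ, x), dist y x ≤ L) {U : E → ℝ} (hU : Measurable U)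
    {D : ℝ} (hD₀ : 0 < D) (hD : ∀ x, U x ≤ D * (1 + ‖x‖) ^ m) {s C : ℝ} (hs : 0 < s) (hC : 0 < C)
    (hdrift : ∀ᶠ σ : ℝ in atTop, ∀ γ x, 2 * σ ≤ ‖x‖ →
      ∫⁻ y, ENNReal.ofReal (Real.exp (s * U y)) ∂P (γ, x) ≤
        ENNReal.ofReal (1 + C * σ ^ (m - p)) * ENNReal.ofReal (Real.exp (s * U x))) :
    ∀ᶠ σ : ℝ in atTop, ∀ x₀ : E, ‖x₀‖ ≤ σ → ∀ (γ₀ : Y) (t : ℕ), (t : ℝ) ≤ σ ^ p → ∀ Q,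
      ∫⁻ x, ENNReal.ofReal (Real.exp (s * U x)) ∂adaptiveMarginal P Q t γ₀ x₀ ≤
        ENNReal.ofReal (Real.exp ((C + s * D * 4 ^ m + 1) * σ ^ m)) := by
  filter_upwards [hdrift, eventually_ge_atTop L, eventually_ge_atTop 1,
    eventually_mul_rpow_le_exp_mul_rpow 2 p one_pos hm,
    eventually_mul_rpow_le_exp_mul_rpow 2 0 one_pos hm]
    with σ hσ hσL hσ1 hexp hexp' x₀ hx₀ γ₀ t ht Q
  have hσ0 : 0 < σ := one_pos.trans_le hσ1
  set b := Real.exp (s * (D * (4 * σ) ^ m))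
  have hnear {y : E} (hy : ‖y‖ ≤ 3 * σ) : Real.exp (s * U y) ≤ b := by
    have h : U y ≤ D * (4 * σ) ^ m := (hD y).trans (by gcongr; linarith)
    exact Real.exp_le_exp.2 (by gcongr)
  have hstep (γ x) : ∫⁻ y, ENNReal.ofReal (Real.exp (s * U y)) ∂P (γ, x) ≤
      ENNReal.ofReal (1 + C * σ ^ (m - p)) * ENNReal.ofReal (Real.exp (s * U x)) +
        ENNReal.ofReal b := by
    rcases le_total (2 * σ) ‖x‖ with hx | hx
    · exact (hσ γ x hx).trans le_self_add
    · refine le_add_of_nonneg_of_le zero_le (lintegral_le_const ?_)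
      filter_upwards [hP γ x] with y hy
      rw [dist_eq_norm] at hy
      exact ENNReal.ofReal_le_ofReal (hnear (by linarith [norm_sub_norm_le y x]))
  refine (lintegral_adaptiveMarginal_le_of_drift P Q γ₀ x₀ (by fun_prop)
    (ENNReal.one_le_ofReal.2 (le_add_of_nonneg_right (by positivity))) hstep t).trans ?_
  rw [← ENNReal.ofReal_natCast, ← ENNReal.ofReal_mul (by positivity),
    ← ENNReal.ofReal_add (by positivity) (by positivity), ← ENNReal.ofReal_pow (by positivity),
    ← ENNReal.ofReal_mul (by positivity)]
  rw [one_mul] at hexp hexp'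
  rw [Real.rpow_zero] at hexp'
  refine ENNReal.ofReal_le_ofReal ((one_add_mul_rpow_pow_mul_add_le hC.le hσ0 ht (by linarith)
    (Real.exp_pos _).le (hnear (by linarith))).trans_eq ?_)
  rw [← Real.exp_add, Real.mul_rpow (by norm_num) hσ0.le]
  ring_nf

theorem hasTailDecayUntil_of_drift [OpensMeasurableSpace E] (hm : 0 < m) {L : ℝ}
    (hP : ∀ γ x, ∀ᵐ y ∂P (γ, x), dist y x ≤ L) {U : E → ℝ} (hU : Measurable U)
    {D : ℝ} (hD₀ : 0 < D) (hD : ∀ x, U x ≤ D * (1 + ‖x‖) ^ m)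
    {a R : ℝ} (ha₀ : 0 < a) (ha : ∀ x, R ≤ ‖x‖ → a * ‖x‖ ^ m ≤ U x)
    (hdrift : ∀ s : ℝ, 0 < s → ∃ C : ℝ, 0 < C ∧ ∀ᶠ σ : ℝ in atTop, ∀ γ x, 2 * σ ≤ ‖x‖ →
      ∫⁻ y, ENNReal.ofReal (Real.exp (s * U y)) ∂P (γ, x) ≤
        ENNReal.ofReal (1 + C * σ ^ (m - p)) * ENNReal.ofReal (Real.exp (s * U x))) :
    HasTailDecayUntil P m p := by
  intro A
  -- Apply the Markov inequality at radius `B * σ`, where `B ^ m` is the constant of the moment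
  -- bound: that bound then reads `exp ((B * σ) ^ m)`, and `s` leaves a surplus rate of `|A|`.
  set s := (|A| + 1) / a with hs
  obtain ⟨C, hC, hC'⟩ := hdrift s (by positivity)
  have hmoment :=
    eventually_lintegral_exp_adaptiveMarginal_le hm hP hU hD₀ hD (by positivity) hC hC'
  set C' := C + s * D * 4 ^ m + 1
  have hC'1 : 1 ≤ C' := le_add_of_nonneg_left (by positivity)
  set B := C' ^ m⁻¹
  have hBm : B ^ m = C' := Real.rpow_inv_rpow (by positivity) hm.ne'
  have hB : 1 ≤ B := Real.one_le_rpow hC'1 (by positivity)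
  refine ⟨B, hB, ?_⟩
  filter_upwards [hmoment, eventually_ge_atTop R, eventually_ge_atTop 1]
    with σ hσ hσR hσ1 x₀ hx₀ γ₀ t ht Q
  set r := B * σ
  have hr : σ ≤ r := le_mul_of_one_le_left (by positivity) hB
  have hrm : r ^ m = C' * σ ^ m := by rw [Real.mul_rpow (by positivity) (by positivity), hBm]
  have hsub : (closedBall 0 r)ᶜ ⊆ {x : E | ENNReal.ofReal (Real.exp (s * (a * r ^ m))) ≤
      ENNReal.ofReal (Real.exp (s * U x))} := by
    intro x hx
    rw [Set.mem_compl_iff, mem_closedBall_zero_iff, not_le] at hx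
    have hUx : a * r ^ m ≤ U x := le_trans (by gcongr) (ha x (by linarith))
    exact ENNReal.ofReal_le_ofReal (by gcongr)
  calc _ ≤ (∫⁻ x, ENNReal.ofReal (Real.exp (s * U x)) ∂adaptiveMarginal P Q t γ₀ x₀) /
          ENNReal.ofReal (Real.exp (s * (a * r ^ m))) :=
        (measure_mono hsub).trans (meas_ge_le_lintegral_div (by fun_prop)
          (by simp [Real.exp_pos]) ENNReal.ofReal_ne_top)
    _ ≤ ENNReal.ofReal (Real.exp (r ^ m)) / ENNReal.ofReal (Real.exp (s * (a * r ^ m))) := by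
        rw [hrm]
        gcongr
        exact hσ x₀ hx₀ γ₀ t ht Q
    _ = ENNReal.ofReal (Real.exp (-(|A| * r ^ m))) := by
        rw [← ENNReal.ofReal_div_of_pos (Real.exp_pos _), ← Real.exp_sub, hs]
        congr 2
        field_simp
        ring
    _ ≤ ENNReal.ofReal (Real.exp (-(A * r ^ m))) := by
        gcongr
        exact le_abs_self A

theorem HasTailDecayUntil.exists_eventually_exp_le_wassersteinMinOne [OpensMeasurableSpace E]
    (hP : HasTailDecayUntil P m p) {ν : Measure E} {A : ℝ} (hA : 0 < A)
    (hν : ∀ᶠ ρ : ℝ in atTop,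
      ENNReal.ofReal (2 * Real.exp (-(A * ρ ^ m))) ≤ ν (ball 0 (ρ + 1))ᶜ) :
    ∃ c : ℝ, 0 < c ∧ ∀ᶠ σ : ℝ in atTop, ∀ x₀ : E, ‖x₀‖ ≤ σ →
      ∀ (γ₀ : Y) (t : ℕ), (t : ℝ) ≤ σ ^ p → ∀ Q,
        ENNReal.ofReal (Real.exp (-(c * σ ^ m))) ≤
          wassersteinMinOne (adaptiveMarginal P Q t γ₀ x₀) ν := by
  obtain ⟨B, hB, htail⟩ := hP A
  have hB₀ : 0 < B := one_pos.trans_le hB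
  refine ⟨A * B ^ m, by positivity, ?_⟩
  filter_upwards [htail, (tendsto_id.const_mul_atTop hB₀).eventually hν, eventually_ge_atTop 0]
    with σ hσ hσν hσ0 x₀ hx₀ γ₀ t ht Q
  rw [id] at hσν
  rw [mul_assoc, ← Real.mul_rpow hB₀.le hσ0]
  set ε := ENNReal.ofReal (Real.exp (-(A * (B * σ) ^ m)))
  have hfar : ∀ x ∈ closedBall (0 : E) (B * σ), ∀ y ∈ (ball (0 : E) (B * σ + 1))ᶜ,
      1 ≤ dist x y := by
    intro x hx y hy
    rw [Set.mem_compl_iff, mem_ball, not_lt] at hy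
    rw [mem_closedBall] at hx
    linarith [dist_triangle_left y 0 x]
  refine (ENNReal.add_le_add_iff_right (a := ε) ENNReal.ofReal_ne_top).1 ?_
  calc ε + ε = ENNReal.ofReal (2 * Real.exp (-(A * (B * σ) ^ m))) := by
        rw [two_mul, ENNReal.ofReal_add (Real.exp_pos _).le (Real.exp_pos _).le]
    _ ≤ ν (ball 0 (B * σ + 1))ᶜ := hσν
    _ ≤ wassersteinMinOne (adaptiveMarginal P Q t γ₀ x₀) ν +
          adaptiveMarginal P Q t γ₀ x₀ (closedBall 0 (B * σ))ᶜ :=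
        measure_le_wassersteinMinOne_add_measure_compl _ ν measurableSet_closedBall
          measurableSet_ball.compl hfar
    _ ≤ wassersteinMinOne (adaptiveMarginal P Q t γ₀ x₀) ν + ε := by
        gcongr
        exact hσ x₀ hx₀ γ₀ t ht Q

theorem HasTailDecayUntil.exists_mul_exp_le_iInf_wassersteinMinOne [OpensMeasurableSpace E]
    (hP : HasTailDecayUntil P m p) (hp : 0 < p) {ν : Measure E} {A : ℝ} (hA : 0 < A)
    (hν : ∀ᶠ ρ : ℝ in atTop,
      ENNReal.ofReal (2 * Real.exp (-(A * ρ ^ m))) ≤ ν (ball 0 (ρ + 1))ᶜ) :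
    ∃ c : ℝ, 0 < c ∧ ∀ x₀ : E, ∃ M : ℝ, 0 < M ∧ ∀ (γ₀ : Y) (t : ℕ),
      ENNReal.ofReal (M * Real.exp (-c * (t : ℝ) ^ (m / p))) ≤
        ⨅ Q : AdaptationPlan Y E, wassersteinMinOne (adaptiveMarginal P Q t γ₀ x₀) ν := by
  obtain ⟨c, hc, h⟩ := hP.exists_eventually_exp_le_wassersteinMinOne hA hν
  obtain ⟨σ₀, hσ₀⟩ := eventually_atTop.1 h
  refine ⟨c, hc, fun x₀ => ?_⟩
  set a := max σ₀ ‖x₀‖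
  have : 0 ≤ a := (norm_nonneg x₀).trans (le_max_right _ _)
  refine ⟨Real.exp (-(c * a ^ m)), Real.exp_pos _, fun γ₀ t => le_iInf fun Q => ?_⟩
  set σ := max a ((t : ℝ) ^ p⁻¹)
  have htσ : (t : ℝ) ≤ σ ^ p := by
    calc (t : ℝ) = ((t : ℝ) ^ p⁻¹) ^ p := (Real.rpow_inv_rpow t.cast_nonneg hp.ne').symm
      _ ≤ σ ^ p := by
        gcongr
        exact le_max_right _ _
  have hσm : σ ^ m ≤ a ^ m + (t : ℝ) ^ (m / p) := by
    have ht : ((t : ℝ) ^ p⁻¹) ^ m = (t : ℝ) ^ (m / p) := by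
      rw [← Real.rpow_mul t.cast_nonneg, inv_mul_eq_div]
    rw [← ht]
    rcases max_choice a ((t : ℝ) ^ p⁻¹) with h | h
    · exact (congrArg (· ^ m) h).le.trans (le_add_of_nonneg_right (by positivity))
    · exact (congrArg (· ^ m) h).le.trans (le_add_of_nonneg_left (by positivity))
  refine le_trans (ENNReal.ofReal_le_ofReal ?_) (hσ₀ σ ((le_max_left _ _).trans (le_max_left _ _))
    x₀ ((le_max_right _ _).trans (le_max_left _ _)) γ₀ t htσ Q)
  rw [← Real.exp_add]
  gcongr
  linarith [mul_le_mul_of_nonneg_left hσm hc.le]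

end TailDecay

section Metropolis

variable {d : ℕ}

theorem inner_toEuclideanCLM_le_of_le {A B : Matrix (Fin d) (Fin d) ℝ} (hAB : A ≤ B)
    (ξ : EuclideanSpace ℝ (Fin d)) :
    inner ℝ ξ (Matrix.toEuclideanCLM (𝕜 := ℝ) A ξ) ≤
      inner ℝ ξ (Matrix.toEuclideanCLM (𝕜 := ℝ) B ξ) := by
  have h := (Matrix.le_iff.1 hAB).dotProduct_mulVec_nonneg ξ.ofLp
  rwa [dotProduct_comm, ← Matrix.ofLp_toEuclideanCLM,
    ← EuclideanSpace.inner_eq_star_dotProduct, map_sub, sub_apply, inner_sub_right,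
    sub_nonneg] at h

theorem norm_toEuclideanCLM_sqrt_le {γ : Matrix (Fin d) (Fin d) ℝ} {hi : ℝ} (hγ₀ : 0 ≤ γ)
    (hγ : γ ≤ hi • 1) : ‖Matrix.toEuclideanCLM (𝕜 := ℝ) (CFC.sqrt γ)‖ ≤ √hi := by
  set T := Matrix.toEuclideanCLM (𝕜 := ℝ) (n := Fin d)
  have hadj : (T (CFC.sqrt γ)).adjoint = T (CFC.sqrt γ) := by
    rw [← ContinuousLinearMap.star_eq_adjoint, ← map_star,
      (CFC.sqrt_nonneg γ).isSelfAdjoint.star_eq]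
  refine ContinuousLinearMap.opNorm_le_bound _ hi.sqrt_nonneg fun ξ => ?_
  rw [← Real.sqrt_sq (norm_nonneg ξ), ← Real.sqrt_mul' hi (sq_nonneg ‖ξ‖)]
  refine Real.le_sqrt_of_sq_le ?_
  calc ‖T (CFC.sqrt γ) ξ‖ ^ 2 = inner ℝ ξ (T γ ξ) := by
        rw [← real_inner_self_eq_norm_sq, ← ContinuousLinearMap.adjoint_inner_right, hadj,
          ← mul_apply_eq_comp, ← map_mul, CFC.sqrt_mul_sqrt_self γ hγ₀]
    _ ≤ inner ℝ ξ (T (hi • 1) ξ) := inner_toEuclideanCLM_le_of_le hγ ξ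
    _ = hi * ‖ξ‖ ^ 2 := by
        rw [map_smul, map_one, smul_apply, one_apply_eq_self, inner_smul_right,
          real_inner_self_eq_norm_sq]

/-- The law of the noise `ξ` that drives the proposal. -/
noncomputable def ProposalDensity.noiseLaw (q : ProposalDensity d) :
    Measure (EuclideanSpace ℝ (Fin d)) :=
  volume.withDensity fun ξ => ENNReal.ofReal (q.g ξ)

instance ProposalDensity.isProbabilityMeasure_noiseLaw (q : ProposalDensity d) :
    IsProbabilityMeasure q.noiseLaw :=
  ⟨by rw [noiseLaw, withDensity_apply _ .univ, setLIntegral_univ, q.lintegral_eq_one]⟩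

instance ProposalDensity.isNegInvariant_noiseLaw (q : ProposalDensity d) :
    q.noiseLaw.IsNegInvariant := by
  refine ⟨Measure.ext_of_lintegral _ fun f hf => ?_⟩
  have hg := q.measurable_g
  rw [Measure.neg_def, lintegral_map hf measurable_neg, noiseLaw,
    lintegral_withDensity_eq_lintegral_mul _ (by fun_prop) (by fun_prop),
    lintegral_withDensity_eq_lintegral_mul _ (by fun_prop) hf, ← lintegral_neg_eq_self]
  simp only [Pi.mul_apply, neg_neg, q.radial _ _ (norm_neg _)]

theorem ProposalDensity.ae_mem_K (q : ProposalDensity d) : ∀ᵐ ξ ∂q.noiseLaw, ξ ∈ q.K := by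
  refine (ae_withDensity_iff q.measurable_g.ennreal_ofReal).2 (Filter.Eventually.of_forall ?_)
  intro ξ hξ
  contrapose! hξ
  rw [q.eq_zero ξ hξ, ENNReal.ofReal_zero]

theorem ProposalDensity.exists_ae_norm_increment_le (q : ProposalDensity d) {lo : ℝ}
    (hlo : 0 < lo) (hi : ℝ) :
    ∃ L : ℝ, 0 ≤ L ∧ ∀ γ : covarianceSet d lo hi,
      ∀ᵐ ξ ∂q.noiseLaw, ‖Matrix.toEuclideanCLM (𝕜 := ℝ) (CFC.sqrt γ.1) ξ‖ ≤ L := by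
  obtain ⟨C, hC₀, hC⟩ := q.isCompact_K.isBounded.exists_pos_norm_le
  refine ⟨√hi * C, by positivity, fun γ => q.ae_mem_K.mono fun ξ hξ => ?_⟩
  exact ContinuousLinearMap.le_of_opNorm_le_of_le _
    (norm_toEuclideanCLM_sqrt_le (covarianceSet_nonneg hlo γ) γ.2.2.1) (hC ξ hξ)

variable {U : EuclideanSpace ℝ (Fin d) → ℝ} (hU : Measurable U) (q : ProposalDensity d)
  (γ : Matrix (Fin d) (Fin d) ℝ) (x : EuclideanSpace ℝ (Fin d))

theorem acceptance_le_one (U : EuclideanSpace ℝ (Fin d) → ℝ) (x y : EuclideanSpace ℝ (Fin d)) :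
    acceptance U x y ≤ 1 :=
  min_le_right _ _

include hU

theorem measurable_acceptance_proposalPoint :
    Measurable fun ξ => acceptance U x (proposalPoint γ x ξ) := by
  have hp := measurable_proposalPoint_right γ x
  unfold acceptance
  fun_prop

theorem ofReal_rejection :
    ENNReal.ofReal (rejection U q γ x) =
      ∫⁻ ξ, ENNReal.ofReal (1 - acceptance U x (proposalPoint γ x ξ)) ∂q.noiseLaw := by
  have hint : Integrable (fun ξ => acceptance U x (proposalPoint γ x ξ)) q.noiseLaw :=
    .of_mem_Icc 0 1 (measurable_acceptance_proposalPoint hU γ x).aemeasurable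
      (.of_forall fun ξ => ⟨acceptance_nonneg U x _, acceptance_le_one U x _⟩)
  have hrej : rejection U q γ x =
      ∫ ξ, (1 - acceptance U x (proposalPoint γ x ξ)) ∂q.noiseLaw := by
    rw [integral_sub (integrable_const 1) hint, integral_const, probReal_univ, one_smul, rejection,
      ProposalDensity.noiseLaw, integral_withDensity_eq_integral_toReal_smul
        q.measurable_g.ennreal_ofReal (.of_forall fun _ => ENNReal.ofReal_lt_top)]
    simp only [ENNReal.toReal_ofReal (q.nonneg _), smul_eq_mul, mul_comm]
  rw [hrej]
  exact ofReal_integral_eq_lintegral_ofReal ((integrable_const 1).sub hint) <|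
    .of_forall fun ξ => sub_nonneg.2 (acceptance_le_one U x _)

theorem withDensity_acceptance_mul_eq :
    (volume.withDensity fun ξ => ENNReal.ofReal (acceptance U x (proposalPoint γ x ξ) * q.g ξ)) =
      q.noiseLaw.withDensity fun ξ => ENNReal.ofReal (acceptance U x (proposalPoint γ x ξ)) := by
  rw [ProposalDensity.noiseLaw, ← withDensity_mul _ q.measurable_g.ennreal_ofReal
    (measurable_acceptance_proposalPoint hU γ x).ennreal_ofReal]
  refine congrArg _ (funext fun ξ => ?_)
  rw [Pi.mul_apply, ← ENNReal.ofReal_mul (q.nonneg ξ), mul_comm]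

theorem lintegral_rwmMeasure {F : EuclideanSpace ℝ (Fin d) → ℝ≥0∞} (hF : Measurable F) :
    ∫⁻ y, F y ∂rwmMeasure U q γ x =
      ∫⁻ ξ, (ENNReal.ofReal (acceptance U x (proposalPoint γ x ξ)) * F (proposalPoint γ x ξ) +
        ENNReal.ofReal (1 - acceptance U x (proposalPoint γ x ξ)) * F x) ∂q.noiseLaw := by
  have hp := measurable_proposalPoint_right γ x
  have := measurable_acceptance_proposalPoint hU γ x
  rw [rwmMeasure, withDensity_acceptance_mul_eq hU, lintegral_add_measure, lintegral_map hF hp,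
    lintegral_smul_measure, lintegral_dirac' _ hF, smul_eq_mul, ofReal_rejection hU,
    ← lintegral_mul_const _ (by fun_prop), lintegral_add_right _ (by fun_prop),
    lintegral_withDensity_eq_lintegral_mul _ (by fun_prop) (by fun_prop)]
  rfl

theorem ae_dist_le_rwmMeasure {L : ℝ} (hL : 0 ≤ L)
    (hγ : ∀ᵐ ξ ∂q.noiseLaw, ‖Matrix.toEuclideanCLM (𝕜 := ℝ) (CFC.sqrt γ) ξ‖ ≤ L) :
    ∀ᵐ y ∂rwmMeasure U q γ x, dist y x ≤ L := by
  have hs : MeasurableSet (Metric.closedBall x L)ᶜ := Metric.isClosed_closedBall.measurableSet.compl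
  suffices rwmMeasure U q γ x (Metric.closedBall x L)ᶜ = 0 from this
  rw [← lintegral_indicator_one hs, lintegral_rwmMeasure hU q γ x (measurable_one.indicator hs)]
  refine (lintegral_congr_ae ?_).trans lintegral_zero
  filter_upwards [hγ] with ξ hξ
  simp [proposalPoint, hL, hξ]

theorem lintegral_rwmMeasure_le {Φ : ℝ → ℝ≥0∞} (hΦ : Monotone Φ) :
    ∫⁻ y, Φ (U y) ∂rwmMeasure U q γ x ≤ ∫⁻ ξ, Φ (U (proposalPoint γ x ξ)) ∂q.noiseLaw := by
  rw [lintegral_rwmMeasure hU q γ x (F := fun y => Φ (U y)) (hΦ.measurable.comp hU)]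
  refine lintegral_mono fun ξ => ?_
  set y := proposalPoint γ x ξ
  rcases le_total (U x) (U y) with h | h
  · calc ENNReal.ofReal (acceptance U x y) * Φ (U y) +
          ENNReal.ofReal (1 - acceptance U x y) * Φ (U x)
        ≤ ENNReal.ofReal (acceptance U x y) * Φ (U y) +
          ENNReal.ofReal (1 - acceptance U x y) * Φ (U y) := by
          gcongr
          exact hΦ h
      _ = Φ (U y) := by
          rw [← add_mul, ← ENNReal.ofReal_add (acceptance_nonneg U x y)
            (sub_nonneg.2 (acceptance_le_one U x y)), add_sub_cancel, ENNReal.ofReal_one, one_mul]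
  · have hacc : acceptance U x y = 1 := min_eq_right (Real.one_le_exp (sub_nonneg.2 h))
    simp [hacc]

end Metropolis

theorem lintegral_le_of_add_neg_le {G : Type*} [MeasurableSpace G] [InvolutiveNeg G]
    [MeasurableNeg G] {μ : Measure G} [IsProbabilityMeasure μ] [μ.IsNegInvariant] {F : G → ℝ≥0∞}
    (hF : Measurable F) {b : ℝ≥0∞} (hb : ∀ᵐ ξ ∂μ, F ξ + F (-ξ) ≤ 2 * b) :
    ∫⁻ ξ, F ξ ∂μ ≤ b := by
  refine (ENNReal.mul_le_mul_iff_right two_ne_zero ENNReal.ofNat_ne_top).1 ?_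
  calc 2 * ∫⁻ ξ, F ξ ∂μ = ∫⁻ ξ, (F ξ + F (-ξ)) ∂μ := by
        rw [lintegral_add_left hF, lintegral_neg_eq_self, two_mul]
    _ ≤ 2 * b := lintegral_le_const hb

section SecondOrder

open Metric

variable {E F : Type*} [NormedAddCommGroup E] [NormedSpace ℝ E] [NormedAddCommGroup F]
  [NormedSpace ℝ F] {x h : E} {L : ℝ}

theorem norm_sub_le_of_norm_fderiv_le_closedBall {f : E → F} (hf : Differentiable ℝ f) {G : ℝ}
    (hG : ∀ z ∈ closedBall x L, ‖fderiv ℝ f z‖ ≤ G) {y z : E} (hy : y ∈ closedBall x L)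
    (hz : z ∈ closedBall x L) : ‖f z - f y‖ ≤ G * ‖z - y‖ :=
  (convex_closedBall x L).norm_image_sub_le_of_norm_fderiv_le (fun w _ => hf w) hG hy hz

theorem second_difference_le {f : E → ℝ} (hf : ContDiff ℝ 2 f) {H : ℝ}
    (hH : ∀ z ∈ closedBall x L, ‖fderiv ℝ (fderiv ℝ f) z‖ ≤ H) (hh : ‖h‖ ≤ L) :
    f (x + h) + f (x - h) - 2 * f x ≤ 2 * H * L ^ 2 := by
  have hL : 0 ≤ L := (norm_nonneg h).trans hh
  have hH₀ : 0 ≤ H := (norm_nonneg (fderiv ℝ (fderiv ℝ f) x)).trans (hH x (mem_closedBall_self hL))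
  have hf₁ : Differentiable ℝ f := hf.differentiable two_ne_zero
  have hf₂ : Differentiable ℝ (fderiv ℝ f) :=
    (hf.fderiv_right (m := 1) (by norm_num)).differentiable one_ne_zero
  have hderiv (k : E) : HasFDerivAt (fun k => f (x + k) + f (x - k))
      (fderiv ℝ f (x + k) - fderiv ℝ f (x - k)) k := by
    convert! ((hf₁ (x + k)).hasFDerivAt.comp k ((hasFDerivAt_id k).const_add x)).add
      ((hf₁ (x - k)).hasFDerivAt.comp k ((hasFDerivAt_id k).const_sub x)) using 1
    ext v
    simp [sub_eq_add_neg]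
  have hbound : ∀ k ∈ closedBall (0 : E) L,
      ‖fderiv ℝ f (x + k) - fderiv ℝ f (x - k)‖ ≤ H * (2 * L) := by
    intro k hk
    rw [mem_closedBall_zero_iff] at hk
    refine (norm_sub_le_of_norm_fderiv_le_closedBall hf₂ hH (by simpa using hk)
      (by simpa using hk)).trans ?_
    gcongr
    rw [add_sub_sub_cancel]
    linarith [norm_add_le k k]
  have hsum := (convex_closedBall (0 : E) L).norm_image_sub_le_of_norm_hasFDerivWithin_le
    (fun k _ => (hderiv k).hasFDerivWithinAt) hbound (mem_closedBall_self hL)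
    (mem_closedBall_zero_iff.2 hh)
  rw [add_zero, sub_zero, sub_zero, ← two_mul] at hsum
  calc f (x + h) + f (x - h) - 2 * f x ≤ H * (2 * L) * ‖h‖ := (le_abs_self _).trans hsum
    _ ≤ H * (2 * L) * L := by gcongr
    _ = 2 * H * L ^ 2 := by ring

theorem exp_add_exp_le {a b δ η : ℝ} (ha : |a| ≤ δ) (hb : |b| ≤ δ) (hδ : δ ≤ 1)
    (hab : a + b ≤ η) : Real.exp a + Real.exp b ≤ 2 + η + 2 * δ ^ 2 := by
  have hexp {u : ℝ} (hu : |u| ≤ δ) : Real.exp u ≤ 1 + u + δ ^ 2 := by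
    linarith [(abs_le.1 (Real.abs_exp_sub_one_sub_id_le (hu.trans hδ))).2,
      sq_le_sq' (abs_le.1 hu).1 (abs_le.1 hu).2]
  linarith [hexp ha, hexp hb]

theorem exp_mul_add_exp_mul_le {f : E → ℝ} (hf : ContDiff ℝ 2 f) {s G H : ℝ} (hs : 0 ≤ s)
    (hG : ∀ z ∈ closedBall x L, ‖fderiv ℝ f z‖ ≤ G)
    (hH : ∀ z ∈ closedBall x L, ‖fderiv ℝ (fderiv ℝ f) z‖ ≤ H) (hsG : s * (G * L) ≤ 1)
    (hh : ‖h‖ ≤ L) :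
    Real.exp (s * f (x + h)) + Real.exp (s * f (x - h)) ≤
      2 * ((1 + s * H * L ^ 2 + (s * (G * L)) ^ 2) * Real.exp (s * f x)) := by
  have hx : x ∈ closedBall x L := mem_closedBall_self ((norm_nonneg h).trans hh)
  have hfirst {y : E} (hy : y ∈ closedBall x L) : |s * (f y - f x)| ≤ s * (G * L) := by
    rw [abs_mul, abs_of_nonneg hs]
    gcongr
    refine (norm_sub_le_of_norm_fderiv_le_closedBall (hf.differentiable two_ne_zero) hG hx
      hy).trans ?_
    have hG₀ : 0 ≤ G := (norm_nonneg _).trans (hG x hx)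
    gcongr
    exact mem_closedBall_iff_norm.1 hy
  have hsecond : s * (f (x + h) - f x) + s * (f (x - h) - f x) ≤ s * (2 * H * L ^ 2) := by
    rw [← mul_add]
    gcongr
    linarith [second_difference_le hf hH hh]
  have hexp (y : E) : Real.exp (s * f y) = Real.exp (s * (f y - f x)) * Real.exp (s * f x) := by
    rw [← Real.exp_add]
    ring_nf
  rw [hexp (x + h), hexp (x - h), ← add_mul, ← mul_assoc]
  gcongr
  linarith [exp_add_exp_le (hfirst (y := x + h) (by simpa using hh))
    (hfirst (y := x - h) (by simpa using hh)) hsG hsecond]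

end SecondOrder

theorem lintegral_exp_rwmMeasure_le {d : ℕ} {U : EuclideanSpace ℝ (Fin d) → ℝ}
    (hU : ContDiff ℝ 2 U) (q : ProposalDensity d) (γ : Matrix (Fin d) (Fin d) ℝ) {L : ℝ}
    (hγ : ∀ᵐ ξ ∂q.noiseLaw, ‖Matrix.toEuclideanCLM (𝕜 := ℝ) (CFC.sqrt γ) ξ‖ ≤ L)
    (x : EuclideanSpace ℝ (Fin d)) {s G H : ℝ} (hs : 0 ≤ s)
    (hG : ∀ z ∈ Metric.closedBall x L, ‖fderiv ℝ U z‖ ≤ G)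
    (hH : ∀ z ∈ Metric.closedBall x L, ‖fderiv ℝ (fderiv ℝ U) z‖ ≤ H) (hsG : s * (G * L) ≤ 1) :
    ∫⁻ y, ENNReal.ofReal (Real.exp (s * U y)) ∂rwmMeasure U q γ x ≤
      ENNReal.ofReal ((1 + s * H * L ^ 2 + (s * (G * L)) ^ 2) * Real.exp (s * U x)) := by
  have hUm : Measurable U := hU.continuous.measurable
  have hp := measurable_proposalPoint_right γ x
  have hmono : Monotone fun u => ENNReal.ofReal (Real.exp (s * u)) := fun u v huv =>
    ENNReal.ofReal_le_ofReal (Real.exp_le_exp.2 (by gcongr))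
  refine (lintegral_rwmMeasure_le hUm q γ x hmono).trans
    (lintegral_le_of_add_neg_le (by fun_prop) (hγ.mono fun ξ hξ => ?_))
  have hpair := exp_mul_add_exp_mul_le hU hs hG hH hsG hξ
  rw [← ENNReal.ofReal_add (Real.exp_pos _).le (Real.exp_pos _).le, proposalPoint, proposalPoint,
    map_neg, ← sub_eq_add_neg]
  exact (ENNReal.ofReal_le_ofReal hpair).trans_eq
    (by rw [ENNReal.ofReal_mul zero_le_two, ENNReal.ofReal_ofNat])

theorem opNorm_le_sqrt_sum_sq {ι F : Type*} [Fintype ι] [NormedAddCommGroup F]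
    [InnerProductSpace ℝ F] (b : OrthonormalBasis ι ℝ F) (B : F →L[ℝ] F →L[ℝ] ℝ) :
    ‖B‖ ≤ √(∑ i, ∑ j, B (b i) (b j) ^ 2) := by
  have hflip (j : ι) : ‖B.flip (b j)‖ ^ 2 = ∑ i, B (b i) (b j) ^ 2 := b.norm_dual _
  refine B.opNorm_le_bound (Real.sqrt_nonneg _) fun v => ?_
  refine le_of_sq_le_sq ?_ (by positivity)
  calc ‖B v‖ ^ 2 = ∑ j, ‖B.flip (b j) v‖ ^ 2 := by
        simp [b.norm_dual]
    _ ≤ ∑ j, (‖B.flip (b j)‖ * ‖v‖) ^ 2 := by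
        gcongr with j
        exact (B.flip (b j)).le_opNorm v
    _ = (√(∑ i, ∑ j, B (b i) (b j) ^ 2) * ‖v‖) ^ 2 := by
        rw [mul_pow, Real.sq_sqrt (by positivity), Finset.sum_comm, Finset.sum_mul]
        simp only [mul_pow, hflip]

theorem norm_fderiv_fderiv_le_frobeniusNorm {d : ℕ} {U : EuclideanSpace ℝ (Fin d) → ℝ}
    (hU : ContDiff ℝ 2 U) (z : EuclideanSpace ℝ (Fin d)) :
    ‖fderiv ℝ (fderiv ℝ U) z‖ ≤ frobeniusNorm (hessianMatrix U z) := by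
  have hd : DifferentiableAt ℝ (fderiv ℝ U) z :=
    (hU.fderiv_right (m := 1) (by norm_num)).differentiable one_ne_zero z
  have hentry (i j : Fin d) : hessianMatrix U z i j =
      fderiv ℝ (fderiv ℝ U) z (EuclideanSpace.single i 1) (EuclideanSpace.single j 1) := by
    simp [hessianMatrix, fderiv_clm_apply hd (differentiableAt_const _)]
  simpa only [frobeniusNorm, hentry, EuclideanSpace.basisFun_apply] using
    opNorm_le_sqrt_sum_sq (EuclideanSpace.basisFun (Fin d) ℝ) (fderiv ℝ (fderiv ℝ U) z)

/-- `C²` potentials of exact order `‖x‖ ^ m` at infinity, whose first two derivatives are there of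
order at most `‖x‖ ^ (m - 1)` and `‖x‖ ^ (m - 2)`. The derivatives are Fréchet derivatives measured
in operator norm, so that no coordinates are involved. -/
structure SmoothPowerGrowth {E : Type*} [NormedAddCommGroup E] [NormedSpace ℝ E] (U : E → ℝ)
    (m : ℝ) : Prop where
  contDiff : ContDiff ℝ 2 U
  exists_bounds : ∃ a D R : ℝ, 0 < a ∧ 0 < D ∧ ∀ x, R ≤ ‖x‖ →
    a * ‖x‖ ^ m ≤ U x ∧ U x ≤ D * ‖x‖ ^ m ∧ ‖fderiv ℝ U x‖ ≤ D * ‖x‖ ^ (m - 1) ∧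
      ‖fderiv ℝ (fderiv ℝ U) x‖ ≤ D * ‖x‖ ^ (m - 2)

theorem PotentialRegularity.smoothPowerGrowth {d : ℕ} {U : EuclideanSpace ℝ (Fin d) → ℝ} {m : ℝ}
    (hU : PotentialRegularity U m) : SmoothPowerGrowth U m where
  contDiff := hU.contDiff
  exists_bounds := by
    obtain ⟨a, _, _, D₁, D₂, D₃, _, R, ha, _, _, hD₁, _, _, _, _, h⟩ := hU.growth
    refine ⟨a, max D₁ (max D₂ D₃), R, ha, lt_max_of_lt_left hD₁, fun x hx => ?_⟩
    obtain ⟨⟨hlow, hup⟩, ⟨-, hgrad⟩, -, ⟨-, hhess⟩⟩ := h x hx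
    have hnorm : ‖gradient U x‖ = ‖fderiv ℝ U x‖ := by simp [gradient]
    refine ⟨hlow, hup.trans ?_, hnorm.symm.trans_le (hgrad.trans ?_),
      (norm_fderiv_fderiv_le_frobeniusNorm hU.contDiff x).trans (hhess.trans ?_)⟩ <;>
    · gcongr
      simp

section Growth

open Filter Metric

variable {E : Type*} [NormedAddCommGroup E] [NormedSpace ℝ E] {U : E → ℝ} {m : ℝ}

theorem SmoothPowerGrowth.exists_le_mul_one_add_norm_rpow [ProperSpace E]
    (hU : SmoothPowerGrowth U m) (hm : 0 ≤ m) :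
    ∃ D : ℝ, 0 < D ∧ ∀ x, U x ≤ D * (1 + ‖x‖) ^ m := by
  obtain ⟨_, D, R, _, hD, h⟩ := hU.exists_bounds
  obtain ⟨C, hC⟩ := (isCompact_closedBall (0 : E) R).exists_bound_of_continuousOn
    hU.contDiff.continuous.continuousOn
  refine ⟨max D C, lt_max_of_lt_left hD, fun x => ?_⟩
  rcases le_total R ‖x‖ with hx | hx
  · calc U x ≤ D * ‖x‖ ^ m := (h x hx).2.1
      _ ≤ max D C * (1 + ‖x‖) ^ m := by
        gcongr
        · exact le_max_left _ _
        · exact le_add_of_nonneg_left zero_le_one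
  · calc U x ≤ C := (le_abs_self _).trans (hC x (mem_closedBall_zero_iff.2 hx))
      _ ≤ max D C := le_max_right _ _
      _ ≤ max D C * (1 + ‖x‖) ^ m := le_mul_of_one_le_right (hD.le.trans (le_max_left _ _))
        (Real.one_le_rpow (le_add_of_nonneg_right (norm_nonneg x)) hm)

theorem SmoothPowerGrowth.integrable_exp_neg [FiniteDimensional ℝ E] [MeasurableSpace E]
    [BorelSpace E] (hU : SmoothPowerGrowth U m) (hm : 0 < m) (μ : Measure E)
    [μ.IsAddHaarMeasure] : Integrable (fun x => Real.exp (-U x)) μ := by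
  have : ProperSpace E := FiniteDimensional.proper_real E
  obtain ⟨a, _, R, ha, _, h⟩ := hU.exists_bounds
  set k : ℝ := Module.finrank ℝ E + 1
  have hcont : Continuous fun x => Real.exp (-U x) :=
    Real.continuous_exp.comp hU.contDiff.continuous.neg
  have hint : Integrable (fun x : E => (1 + ‖x‖) ^ (-k)) μ :=
    integrable_one_add_norm (lt_add_one _)
  refine hcont.locallyIntegrable.integrable_of_isBigO_cocompact
    (Asymptotics.IsBigO.of_bound 1 ?_) (hint.integrableAtFilter _)
  have hnorm := tendsto_norm_cocompact_atTop (E := E)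
  filter_upwards [hnorm.eventually (eventually_mul_rpow_le_exp_mul_rpow (2 ^ k) k ha hm),
    hnorm.eventually (eventually_ge_atTop R), hnorm.eventually (eventually_ge_atTop 1)]
    with x hexp hR h1
  rw [Real.norm_of_nonneg (Real.exp_pos _).le, Real.norm_of_nonneg (by positivity), one_mul,
    Real.exp_neg, Real.rpow_neg (by positivity)]
  gcongr
  calc (1 + ‖x‖) ^ k ≤ (2 * ‖x‖) ^ k := by
        gcongr
        linarith
    _ = 2 ^ k * ‖x‖ ^ k := Real.mul_rpow zero_le_two (norm_nonneg x)
    _ ≤ Real.exp (U x) := hexp.trans (Real.exp_le_exp.2 (h x hR).1)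

end Growth

section Target

open Filter Metric

variable {d : ℕ} {U : EuclideanSpace ℝ (Fin d) → ℝ} {m : ℝ}

theorem mul_volume_closedBall_le_gibbsMeasure_compl_ball (hd : 1 ≤ d) {D : ℝ} (hD₀ : 0 ≤ D)
    (hm : 0 ≤ m) (hD : ∀ x, U x ≤ D * (1 + ‖x‖) ^ m) {r : ℝ} (hr : 0 ≤ r) :
    ENNReal.ofReal (Real.exp (-(D * (r + 3) ^ m)) / ∫ y, Real.exp (-U y)) *
      volume (closedBall (0 : EuclideanSpace ℝ (Fin d)) 1) ≤ gibbsMeasure U (ball 0 r)ᶜ := by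
  have : Nonempty (Fin d) := ⟨⟨0, hd⟩⟩
  obtain ⟨e, he⟩ := exists_norm_eq (EuclideanSpace ℝ (Fin d)) (add_nonneg hr zero_le_one)
  have hnorm {y} (hy : y ∈ closedBall e 1) : r ≤ ‖y‖ ∧ ‖y‖ ≤ r + 2 := by
    rw [mem_closedBall, dist_eq_norm] at hy
    have hle := (abs_le.1 (abs_norm_sub_norm_le y e))
    constructor <;> linarith
  have hsub : closedBall e 1 ⊆ (ball 0 r)ᶜ := fun y hy => by
    simpa using (hnorm hy).1
  rw [← Measure.addHaar_closedBall_center volume e, ← setLIntegral_const]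
  refine le_trans ?_ (measure_mono hsub)
  rw [gibbsMeasure, withDensity_apply _ measurableSet_closedBall]
  refine setLIntegral_mono' measurableSet_closedBall fun y hy => ENNReal.ofReal_le_ofReal ?_
  have hUy : U y ≤ D * (r + 3) ^ m := by
    refine (hD y).trans ?_
    gcongr D * ?_ ^ m
    linarith [(hnorm hy).2]
  gcongr

theorem SmoothPowerGrowth.exists_eventually_exp_le_gibbsMeasure (hU : SmoothPowerGrowth U m)
    (hd : 1 ≤ d) (hm : 0 < m) :
    ∃ A : ℝ, 0 < A ∧ ∀ᶠ ρ : ℝ in atTop,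
      ENNReal.ofReal (2 * Real.exp (-(A * ρ ^ m))) ≤ gibbsMeasure U (ball 0 (ρ + 1))ᶜ := by
  obtain ⟨D, hD₀, hD⟩ := hU.exists_le_mul_one_add_norm_rpow hm.le
  have hZ : 0 < ∫ y, Real.exp (-U y) := integral_exp_pos (hU.integrable_exp_neg hm volume)
  set Z := ∫ y, Real.exp (-U y)
  set v := volume (closedBall (0 : EuclideanSpace ℝ (Fin d)) 1)
  have hv : v ≠ ⊤ := measure_closedBall_lt_top.ne
  have hv₀ : 0 < v.toReal :=
    ENNReal.toReal_pos (measure_closedBall_pos volume _ one_pos).ne' hv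
  refine ⟨D * 2 ^ m + 1, by positivity, ?_⟩
  filter_upwards [eventually_mul_rpow_le_exp_mul_rpow (2 * Z / v.toReal) 0 one_pos hm,
    eventually_ge_atTop 4] with ρ hexp hρ
  rw [Real.rpow_zero, mul_one, one_mul, div_le_iff₀ hv₀] at hexp
  refine le_trans ?_ (mul_volume_closedBall_le_gibbsMeasure_compl_ball hd hD₀.le hm.le hD
    (by linarith : 0 ≤ ρ + 1))
  change _ ≤ ENNReal.ofReal (_ / Z) * v
  rw [← ENNReal.ofReal_toReal hv, ← ENNReal.ofReal_mul (by positivity)]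
  refine ENNReal.ofReal_le_ofReal ?_
  calc 2 * Real.exp (-((D * 2 ^ m + 1) * ρ ^ m))
      = 2 * Z * (Real.exp (-(D * (2 * ρ) ^ m)) / Real.exp (ρ ^ m) / Z) := by
        rw [Real.mul_rpow zero_le_two (by linarith), ← Real.exp_sub]
        field_simp
        ring_nf
    _ ≤ Real.exp (ρ ^ m) * v.toReal * (Real.exp (-(D * (2 * ρ) ^ m)) / Real.exp (ρ ^ m) / Z) := by
        gcongr
    _ = Real.exp (-(D * (2 * ρ) ^ m)) / Z * v.toReal := by field_simp
    _ ≤ Real.exp (-(D * (ρ + 1 + 3) ^ m)) / Z * v.toReal := by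
        gcongr
        linarith

end Target

section Rate

open Filter Metric

variable {d : ℕ} {U : EuclideanSpace ℝ (Fin d) → ℝ} {m : ℝ}

theorem SmoothPowerGrowth.exists_drift_rwmMeasure (hU : SmoothPowerGrowth U m) (hm₀ : 0 ≤ m)
    (hm₁ : m < 1) (q : ProposalDensity d) {lo hi L : ℝ}
    (hγ : ∀ γ : covarianceSet d lo hi, ∀ᵐ ξ ∂q.noiseLaw,
      ‖Matrix.toEuclideanCLM (𝕜 := ℝ) (CFC.sqrt γ.1) ξ‖ ≤ L) {s : ℝ} (hs : 0 < s) :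
    ∃ C : ℝ, 0 < C ∧ ∀ᶠ σ : ℝ in atTop, ∀ (γ : covarianceSet d lo hi) x, 2 * σ ≤ ‖x‖ →
      ∫⁻ y, ENNReal.ofReal (Real.exp (s * U y)) ∂rwmMeasure U q γ.1 x ≤
        ENNReal.ofReal (1 + C * σ ^ (m - (2 - m))) * ENNReal.ofReal (Real.exp (s * U x)) := by
  obtain ⟨_, D, R, _, hD, h⟩ := hU.exists_bounds
  refine ⟨s * D * L ^ 2 + (s * D * L) ^ 2 + 1, by positivity, ?_⟩
  have hsmall := (tendsto_rpow_neg_atTop (sub_pos.2 hm₁)).const_mul (s * D * L)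
  rw [mul_zero, neg_sub] at hsmall
  filter_upwards [eventually_ge_atTop R, eventually_ge_atTop L, eventually_ge_atTop 1,
    hsmall.eventually_le_const one_pos] with σ hσR hσL hσ1 hσs γ x hx
  have hσ0 : 0 < σ := one_pos.trans_le hσ1
  have hfar {z} (hz : z ∈ closedBall x L) : σ ≤ ‖z‖ := by
    rw [mem_closedBall', dist_eq_norm] at hz
    linarith [norm_sub_norm_le x z]
  have hG : ∀ z ∈ closedBall x L, ‖fderiv ℝ U z‖ ≤ D * σ ^ (m - 1) := fun z hz =>
    (h z (hσR.trans (hfar hz))).2.2.1.trans (mul_le_mul_of_nonneg_left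
      (Real.rpow_le_rpow_of_nonpos hσ0 (hfar hz) (by linarith)) hD.le)
  have hH : ∀ z ∈ closedBall x L, ‖fderiv ℝ (fderiv ℝ U) z‖ ≤ D * σ ^ (m - 2) := fun z hz =>
    (h z (hσR.trans (hfar hz))).2.2.2.trans (mul_le_mul_of_nonneg_left
      (Real.rpow_le_rpow_of_nonpos hσ0 (hfar hz) (by linarith)) hD.le)
  refine (lintegral_exp_rwmMeasure_le hU.contDiff q γ.1 (hγ γ) x hs.le hG hH
    (by linarith)).trans ?_
  have hgrad : (σ ^ (m - 1)) ^ 2 = σ ^ (m - (2 - m)) := by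
    rw [← Real.rpow_mul_natCast hσ0.le]
    congr 1
    push_cast
    ring
  have hhess : σ ^ (m - 2) ≤ σ ^ (m - (2 - m)) :=
    Real.rpow_le_rpow_of_exponent_le hσ1 (by linarith)
  rw [← ENNReal.ofReal_mul (by positivity)]
  gcongr ENNReal.ofReal (?_ * _)
  calc 1 + s * (D * σ ^ (m - 2)) * L ^ 2 + (s * (D * σ ^ (m - 1) * L)) ^ 2
      = 1 + s * D * L ^ 2 * σ ^ (m - 2) + (s * D * L) ^ 2 * (σ ^ (m - 1)) ^ 2 := by ring
    _ ≤ 1 + s * D * L ^ 2 * σ ^ (m - (2 - m)) + (s * D * L) ^ 2 * σ ^ (m - (2 - m)) := by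
        rw [hgrad]
        gcongr
    _ ≤ 1 + (s * D * L ^ 2 + (s * D * L) ^ 2 + 1) * σ ^ (m - (2 - m)) := by
        linarith [Real.rpow_pos_of_pos hσ0 (m - (2 - m))]

theorem SmoothPowerGrowth.hasTailDecayUntil_rwmKernel (hU : SmoothPowerGrowth U m) (hm : 0 < m)
    (q : ProposalDensity d) {lo : ℝ} (hlo : 0 < lo) (hi : ℝ) :
    HasTailDecayUntil (rwmKernel U hU.contDiff.continuous.measurable q hlo hi) m
      (max 1 (2 - m)) := by
  obtain ⟨L, hL, hγ⟩ := q.exists_ae_norm_increment_le hlo hi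
  have hUm : Measurable U := hU.contDiff.continuous.measurable
  have hstep : ∀ γ x, ∀ᵐ y ∂rwmKernel U hUm q hlo hi (γ, x), dist y x ≤ L :=
    fun γ x => ae_dist_le_rwmMeasure hUm q γ.1 x hL (hγ γ)
  rcases le_or_gt 1 m with hm₁ | hm₁
  · rw [max_eq_left (by linarith)]
    exact hasTailDecayUntil_one hL hstep m
  · rw [max_eq_right (by linarith)]
    obtain ⟨D, hD₀, hD⟩ := hU.exists_le_mul_one_add_norm_rpow hm.le
    obtain ⟨a, _, R, ha₀, _, h⟩ := hU.exists_bounds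
    exact hasTailDecayUntil_of_drift hm hstep hUm hD₀ hD ha₀ (fun x hx => (h x hx).1)
      fun s hs => hU.exists_drift_rwmMeasure hm.le hm₁ q hγ hs

end Rate

theorem proposition6p1_general {d : ℕ} (hd : 1 ≤ d) {m : ℝ} (hm : 0 < m)
    {U : EuclideanSpace ℝ (Fin d) → ℝ} (hU : SmoothPowerGrowth U m)
    (q : ProposalDensity d) {lo : ℝ} (hlo : 0 < lo) (hi : ℝ) {p : ℝ} (hp : 0 < p)
    (hpm : p ≤ max 1 (2 - m)) :
    ∃ c : ℝ, 0 < c ∧ ∀ x₀ : EuclideanSpace ℝ (Fin d), ∃ M : ℝ, 0 < M ∧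
      ∀ (γ₀ : covarianceSet d lo hi) (t : ℕ),
        ENNReal.ofReal (M * Real.exp (-c * (t : ℝ) ^ (m / p))) ≤
          ⨅ Q : AdaptationPlan (covarianceSet d lo hi) (EuclideanSpace ℝ (Fin d)),
            wassersteinMinOne
              (adaptiveMarginal (rwmKernel U hU.contDiff.continuous.measurable q hlo hi)
                Q t γ₀ x₀)
              (gibbsMeasure U) := by
  obtain ⟨A, hA, htail⟩ := hU.exists_eventually_exp_le_gibbsMeasure hd hm
  exact ((hU.hasTailDecayUntil_rwmKernel hm q hlo hi).mono
    hpm).exists_mul_exp_le_iInf_wassersteinMinOne hp hA htail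

theorem proposition6p1 {d : ℕ} (hd : 1 ≤ d) {m : ℝ} (hm₀ : 0 < m) (hm₂ : m < 2)
    (U : EuclideanSpace ℝ (Fin d) → ℝ) (hU : PotentialRegularity U m)
    (q : ProposalDensity d) {lo : ℝ} (hlo : 0 < lo) (hi : ℝ) :
    ∃ c : ℝ, 0 < c ∧ ∀ x₀ : EuclideanSpace ℝ (Fin d), ∃ M : ℝ, 0 < M ∧
      ∀ (γ₀ : covarianceSet d lo hi) (t : ℕ),
        ENNReal.ofReal (M * Real.exp (-c * (t : ℝ) ^ (m / (2 - m)))) ≤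
          ⨅ Q : AdaptationPlan (covarianceSet d lo hi) (EuclideanSpace ℝ (Fin d)),
            wassersteinMinOne
              (adaptiveMarginal (rwmKernel U hU.contDiff.continuous.measurable q hlo hi)
                Q t γ₀ x₀)
              (gibbsMeasure U) :=
  proposition6p1_general hd hm₀ hU.smoothPowerGrowth q hlo hi (sub_pos.2 hm₂) (le_max_right _ _)
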